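/- All graphs are finite and simple. Write $G \to (3,3)$ if every colouring of the edges of $G$ with two colours contains a monochromatic triangle. Let $G$ be a graph with $G \to (3,3)$ and $K_4 \not\subseteq G$ which is minimal, i.e. $H \not\to (3,3)$ for every proper subgraph $H$ of $G$ (obtained by deleting vertices, edges, or both). Then the minimum degree satisfies $\delta(G) \geq 8$. Moreover, if $v$ is a vertex of $G$ of degree $8$, then the subgraph of $G$ induced by the neighbours of $v$ is isomorphic to one of the following seven triangle-free graphs on the vertex set $\{0,1,\dots,7\}$ (an edge $\{a,b\}$ is written $ab$): - $N_{8.1}$: $02, 21, 03, 31, 04, 45, 51, 06, 67, 71$ (two vertices joined by two paths of length 2 and two paths of length 3, internally disjoint); - $N_{8.2}$: $01, 12, 23, 30, 04, 45, 52, 16, 67, 73$ (a 4-cycle with each pair of opposite vertices joined by a path of length 3); - $N_{8.3}$: the 8-cycle $01, 12, 23, 34, 45, 56, 67, 70$ with the long diagonals $04, 26$; - $N_{8.4}$: the same 8-cycle with the long diagonals $04, 15, 26$; - $N_{8.5}$: $N_{8.1}$ together with the edge $56$; - $N_{8.6}$: the same 8-cycle with all four long diagonals $04, 15, 26, 37$;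 - $N_{8.7}$: $N_{8.1}$ together with the edges $56$ and $47$. -/

import Mathlib

/-- `G → (p, q)` on edges: in every colouring of the edges of `G` with two colours there is a
`p`-clique all of whose edges have the first colour or a `q`-clique all of whose edges have the
second colour. -/
def EdgeArrows {V : Type*} (G : SimpleGraph V) (p q : ℕ) : Prop :=
  ∀ C : G.EdgeLabeling Bool,
    ¬ (C.labelGraph true).CliqueFree p ∨ ¬ (C.labelGraph false).CliqueFree q

/-- The class of graphs `G` with `G → (p, q)` on edges and clique number less than `r`. -/
def IsEdgeFolkman {V : Type*} (G : SimpleGraph V) (p q r : ℕ) : Prop :=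
  EdgeArrows G p q ∧ G.CliqueFree r

/-- A minimal graph in the class `IsEdgeFolkman · p q r`: no proper subgraph (obtained by deleting
vertices, edges, or both) arrows `(p, q)`. -/
def IsMinimalEdgeFolkman {V : Type*} (G : SimpleGraph V) (p q r : ℕ) : Prop :=
  IsEdgeFolkman G p q r ∧ ∀ H : G.Subgraph, H ≠ ⊤ → ¬ EdgeArrows H.coe p q

/-- The edges of the seven graphs `N₁, …, N₇` on eight vertices.

* `N₁`: two hubs `0, 1` joined by two paths of length 2 and two paths of length 3.
* `N₂`: a 4-cycle, both pairs of opposite vertices of which are joined by a path of length 3.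
* `N₃`, `N₄`, `N₆`: an 8-cycle with two perpendicular, with three, and with all four long
  diagonals (the last one is the Wagner graph).
* `N₅`, `N₇`: `N₁` together with the edge `56`, respectively with the edges `56` and `47`. -/
def nEightEdges : Fin 7 → Finset (Sym2 (Fin 8)) := ![
  {s(0, 2), s(2, 1), s(0, 3), s(3, 1), s(0, 4), s(4, 5), s(5, 1), s(0, 6), s(6, 7), s(7, 1)},
  {s(0, 1), s(1, 2), s(2, 3), s(3, 0), s(0, 4), s(4, 5), s(5, 2), s(1, 6), s(6, 7), s(7, 3)},
  {s(0, 1), s(1, 2), s(2, 3), s(3, 4), s(4, 5), s(5, 6), s(6, 7), s(7, 0), s(0, 4), s(2, 6)},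
  {s(0, 1), s(1, 2), s(2, 3), s(3, 4), s(4, 5), s(5, 6), s(6, 7), s(7, 0), s(0, 4), s(1, 5),
    s(2, 6)},
  {s(0, 2), s(2, 1), s(0, 3), s(3, 1), s(0, 4), s(4, 5), s(5, 1), s(0, 6), s(6, 7), s(7, 1),
    s(5, 6)},
  {s(0, 1), s(1, 2), s(2, 3), s(3, 4), s(4, 5), s(5, 6), s(6, 7), s(7, 0), s(0, 4), s(1, 5),
    s(2, 6), s(3, 7)},
  {s(0, 2), s(2, 1), s(0, 3), s(3, 1), s(0, 4), s(4, 5), s(5, 1), s(0, 6), s(6, 7), s(7, 1),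
    s(5, 6), s(4, 7)}]

/-- The seven specific graphs on eight vertices; index `i : Fin 7` stands for number `i + 1`. -/
def nEight (i : Fin 7) : SimpleGraph (Fin 8) :=
  SimpleGraph.fromEdgeSet (nEightEdges i : Set (Sym2 (Fin 8)))

/-!
Call a graph *splitting* (`Splits`) if for every red/blue colouring of its edges the vertices can be
labelled red or blue so that no edge has the colour of both of its ends.

Let `v` be a vertex of a minimal graph `G` that arrows `(3, 3)`. By minimality `G - v` has an edge
colouring without monochromatic triangles. If the neighbourhood graph of `v` were splitting, a
labelling of the neighbours of `v` as above would give colours for the edges at `v` under which no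
triangle through `v` is monochromatic, so `G` would not arrow. Hence the neighbourhood graph is not
splitting (`not_splits_neighborSet`), and it is triangle-free as `G` has no `K₄`. Everything
then follows from a fact on graphs with eight vertices (`splits_or_iso_nEight`): a triangle-free
graph on eight vertices is splitting or isomorphic to one of the seven graphs. A neighbourhood with
fewer vertices would, padded with isolated vertices, be one of the seven as well, but these
have no isolated vertex.

Splitting passes to subgraphs, so the fact is first shown for maximal triangle-free graphs.
Bipartite graphs split, so such a graph may be assumed to contain an odd cycle, and a shortest odd
closed walk is a cycle of length 5 or 7. All maximal triangle-free graphs that extend a fixed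
5-cycle or 7-cycle are enumerated; each of them is splitting or isomorphic to the sixth or the
seventh graph (`splits_or_iso_of_maximal`). The subgraphs of these two are then examined by deleting
one edge at a time (`splits_or_iso_of_checkSubgraphs`). Both enumerations are Boolean functions on
natural numbers that encode graphs by bits; they are proved sound and evaluated by the kernel.
-/

namespace FolkmanNeighborhood

open SimpleGraph

/-! ### Splitting graphs and neighbourhoods in minimal graphs -/

/-- A graph splits if for every colouring of its edges with two colours the vertices can be
labelled with the same two colours so that no edge has the colour of both of its ends. The
colouring is given on all unordered pairs; its values outside the edges play no role. -/
def Splits {V : Type*} (G : SimpleGraph V) : Prop :=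
  ∀ c : Sym2 V → Bool, ∃ f : V → Bool,
    ∀ a b, G.Adj a b → ¬ (f a = c s(a, b) ∧ f b = c s(a, b))

theorem Splits.of_injective_hom {V W : Type*} {G : SimpleGraph V} {H : SimpleGraph W}
    (hG : Splits G) (φ : H →g G) (hφ : Function.Injective φ) : Splits H := by
  intro c
  obtain ⟨f, hf⟩ := hG (Function.extend (Sym2.map φ) c fun _ => true)
  refine ⟨f ∘ φ, fun a b hab => ?_⟩
  have h := hf _ _ (φ.map_adj hab)
  rwa [← Sym2.map_mk, (Sym2.map.injective hφ).extend_apply] at h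

theorem Splits.mono {V : Type*} {G H : SimpleGraph V} (hHG : H ≤ G) (hG : Splits G) : Splits H :=
  hG.of_injective_hom (Hom.ofLE hHG) fun _ _ h => h

theorem Splits.of_colorable_two {V : Type*} {G : SimpleGraph V} (hG : G.Colorable 2) :
    Splits G := by
  obtain ⟨C⟩ := hG
  refine fun c => ⟨fun a => decide (C a = 0), fun a b hab ⟨h₁, h₂⟩ => C.valid hab ?_⟩
  have h := h₁.trans h₂.symm
  rw [decide_eq_decide] at h
  omega

theorem edgeArrows_three_three_iff {V : Type*} {G : SimpleGraph V} :
    EdgeArrows G 3 3 ↔ ∀ c : Sym2 V → Bool, ∃ x y z, G.Adj x y ∧ G.Adj x z ∧ G.Adj y z ∧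
      c s(x, y) = c s(x, z) ∧ c s(x, y) = c s(y, z) := by
  classical
  have key : ∀ (C : G.EdgeLabeling Bool) (k : Bool), ¬ (C.labelGraph k).CliqueFree 3 ↔
      ∃ x y z, ∃ (hxy : G.Adj x y) (hxz : G.Adj x z) (hyz : G.Adj y z),
        C ⟨s(x, y), hxy⟩ = k ∧ C ⟨s(x, z), hxz⟩ = k ∧ C ⟨s(y, z), hyz⟩ = k := by
    intro C k
    simp only [CliqueFree, not_forall, not_not, is3Clique_iff, EdgeLabeling.labelGraph_adj]
    constructor
    · rintro ⟨_, x, y, z, ⟨h₁, h₁'⟩, ⟨h₂, h₂'⟩, ⟨h₃, h₃'⟩, _⟩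
      exact ⟨x, y, z, h₁, h₂, h₃, h₁', h₂', h₃'⟩
    · rintro ⟨x, y, z, h₁, h₂, h₃, h₁', h₂', h₃'⟩
      exact ⟨_, x, y, z, ⟨h₁, h₁'⟩, ⟨h₂, h₂'⟩, ⟨h₃, h₃'⟩, rfl⟩
  simp only [EdgeArrows, key]
  constructor
  · intro h c
    rcases h fun e => c e with ⟨x, y, z, h₁, h₂, h₃, h₁', h₂', h₃'⟩ |
      ⟨x, y, z, h₁, h₂, h₃, h₁', h₂', h₃'⟩ <;>
    exact ⟨x, y, z, h₁, h₂, h₃, by simp_all, by simp_all⟩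
  · intro h C
    obtain ⟨c, hc⟩ : ∃ c : Sym2 V → Bool, ∀ e (he : e ∈ G.edgeSet), c e = C ⟨e, he⟩ :=
      ⟨Function.extend Subtype.val C fun _ => true,
        fun e he => Subtype.val_injective.extend_apply C _ ⟨e, he⟩⟩
    obtain ⟨x, y, z, h₁, h₂, h₃, h, h'⟩ := h c
    rw [hc _ h₁, hc _ h₂] at h
    rw [hc _ h₁, hc _ h₃] at h'
    cases hC : C ⟨s(x, y), h₁⟩
    · exact .inr ⟨x, y, z, h₁, h₂, h₃, hC, h ▸ hC, h' ▸ hC⟩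
    · exact .inl ⟨x, y, z, h₁, h₂, h₃, hC, h ▸ hC, h' ▸ hC⟩

theorem cliqueFree_three_iff {V : Type*} {G : SimpleGraph V} :
    G.CliqueFree 3 ↔ ∀ x y z, G.Adj x y → G.Adj x z → ¬ G.Adj y z := by
  classical
  simp only [CliqueFree, is3Clique_iff]
  constructor
  · intro h x y z h₁ h₂ h₃
    exact h _ ⟨x, y, z, h₁, h₂, h₃, rfl⟩
  · rintro h _ ⟨x, y, z, h₁, h₂, h₃, rfl⟩
    exact h x y z h₁ h₂ h₃

theorem cliqueFree_three_induce_neighborSet {V : Type*} {G : SimpleGraph V} (hG : G.CliqueFree 4)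
    (v : V) : (G.induce (G.neighborSet v)).CliqueFree 3 := by
  classical
  refine cliqueFree_three_iff.2 fun x y z hxy hxz hyz => ?_
  have hclique : G.IsNClique 3 {x.1, y.1, z.1} := is3Clique_iff.2 ⟨x, y, z, hxy, hxz, hyz, rfl⟩
  refine hG _ (hclique.insert (a := v) ?_)
  simpa using ⟨x.2, y.2, z.2⟩

/-- A colouring of the edges of `G - v` without monochromatic triangles, together with a labelling
of the neighbours of `v` that splits its restriction to the neighbourhood, gives a colouring of `G`:
the edge from `v` to `x` gets the label of `x`. -/
theorem not_splits_neighborSet {V : Type*} {G : SimpleGraph V} {r : ℕ}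
    (hG : IsMinimalEdgeFolkman G 3 3 r) (v : V) : ¬ Splits (G.induce (G.neighborSet v)) := by
  classical
  intro hv
  set H : G.Subgraph := (⊤ : G.Subgraph).deleteVerts {v} with hH
  have hHv : ∀ x, x ∈ H.verts ↔ x ≠ v := by simp [hH]
  have hHtop : H ≠ ⊤ := fun h => (hHv v).1 (h ▸ Set.mem_univ v) rfl
  have hadj : ∀ x y : H.verts, H.coe.Adj x y ↔ G.Adj x y := by
    rintro ⟨x, hx⟩ ⟨y, hy⟩
    simp [hH, (hHv x).1 hx, (hHv y).1 hy]
  have hno := hG.2 H hHtop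
  rw [edgeArrows_three_three_iff] at hno
  push Not at hno
  obtain ⟨c, hc⟩ := hno
  -- `c'` extends the colouring `c` of `G - v` to all pairs, `F` the labelling `f` to all vertices.
  obtain ⟨c', hc'⟩ : ∃ c' : Sym2 V → Bool, ∀ x y : H.verts, c' s(x, y) = c s(x, y) :=
    ⟨Function.extend (Sym2.map Subtype.val) c fun _ => true, fun x y => by
      rw [← Sym2.map_mk, (Sym2.map.injective Subtype.val_injective).extend_apply]⟩
  obtain ⟨f, hf⟩ := hv fun e => c' (e.map Subtype.val)
  obtain ⟨F, hF⟩ : ∃ F : V → Bool, ∀ x : G.neighborSet v, F x = f x :=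
    ⟨Function.extend Subtype.val f fun _ => true, fun x => Subtype.val_injective.extend_apply _ _ _⟩
  have hF' : ∀ x y, G.Adj v x → G.Adj v y → G.Adj x y → F x = F y → F x ≠ c' s(x, y) := by
    intro x y hx hy hxy h h'
    refine hf ⟨x, hx⟩ ⟨y, hy⟩ hxy ⟨?_, ?_⟩
    · rw [← hF]; exact h'
    · rw [← hF]; exact h ▸ h'
  -- The colouring of `G` that agrees with `c'` off `v` and with `F` on the edges at `v`.
  obtain ⟨d, hdv, hd⟩ : ∃ d : Sym2 V → Bool, (∀ x, d s(v, x) = F x) ∧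
      ∀ x y, x ≠ v → y ≠ v → d s(x, y) = c' s(x, y) := by
    refine ⟨fun e => decide ((∃ a, e = s(v, a) ∧ F a = true) ∨ v ∉ e ∧ c' e = true), ?_, ?_⟩
    · intro x
      simp only [Sym2.congr_right, Sym2.mem_mk_left, not_true_eq_false, false_and, or_false]
      simp
    · intro x y hx hy
      have hv : ∀ a, s(x, y) ≠ s(v, a) := fun a h =>
        (Sym2.mem_iff.1 (h ▸ Sym2.mem_mk_left v a : v ∈ s(x, y))).elim hx.symm hy.symm
      simp [hv, hx.symm, hy.symm]
  obtain ⟨x, y, z, hxy, hxz, hyz, h, h'⟩ := edgeArrows_three_three_iff.1 hG.1.1 d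
  by_cases hx : x = v
  · subst hx
    rw [hdv, hdv] at h
    rw [hdv, hd _ _ hxy.ne' hxz.ne'] at h'
    exact hF' y z hxy hxz hyz h h'
  by_cases hy : y = v
  · subst hy
    rw [Sym2.eq_swap, hdv, hdv] at h'
    rw [Sym2.eq_swap, hdv, hd _ _ hx hyz.ne'] at h
    exact hF' x z hxy.symm hyz hxz h' h
  by_cases hz : z = v
  · subst hz
    have h'' := h.symm.trans h'
    rw [Sym2.eq_swap, hdv, Sym2.eq_swap, hdv] at h''
    rw [hd _ _ hx hy, Sym2.eq_swap (a := x) (b := z), hdv] at h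
    exact hF' x y hxz.symm hyz.symm hxy h'' h.symm
  rw [hd _ _ hx hy, hd _ _ hx hz, hc' ⟨x, (hHv x).2 hx⟩ ⟨y, (hHv y).2 hy⟩,
    hc' ⟨x, (hHv x).2 hx⟩ ⟨z, (hHv z).2 hz⟩] at h
  rw [hd _ _ hx hy, hd _ _ hy hz, hc' ⟨x, (hHv x).2 hx⟩ ⟨y, (hHv y).2 hy⟩,
    hc' ⟨y, (hHv y).2 hy⟩ ⟨z, (hHv z).2 hz⟩] at h'
  exact hc ⟨x, _⟩ ⟨y, _⟩ ⟨z, _⟩ ((hadj _ _).2 hxy) ((hadj _ _).2 hxz) ((hadj _ _).2 hyz) h h'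

/-! ### Odd cycles -/

/-- A shortest odd closed walk does not repeat a vertex: a repetition would cut it into two shorter
closed walks, one of which is odd. -/
theorem exists_odd_cycle_of_not_colorable_two {V : Type*} {G : SimpleGraph V}
    (hG : ¬ G.Colorable 2) : ∃ (n : ℕ) (u : ℕ → V), Odd n ∧ Set.InjOn u (Set.Iio n) ∧
      u n = u 0 ∧ ∀ i < n, G.Adj (u i) (u (i + 1)) := by
  classical
  rw [two_colorable_iff_forall_loop_even] at hG
  push Not at hG
  have hex : ∃ n, ∃ v, ∃ w : G.Walk v v, w.length = n ∧ Odd n := by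
    obtain ⟨v, w, hw⟩ := hG
    exact ⟨_, v, w, rfl, by simpa using hw⟩
  obtain ⟨v, w, hw, hodd⟩ := Nat.find_spec hex
  have hmin : ∀ x, ∀ w' : G.Walk x x, Odd w'.length → w.length ≤ w'.length := fun x w' h =>
    hw.symm ▸ Nat.find_min' hex ⟨x, w', rfl, h⟩
  rw [← hw] at hodd
  refine ⟨w.length, w.getVert, hodd, ?_, by simp, fun i hi => w.adj_getVert_succ hi⟩
  have hne : ∀ i j, i < j → j < w.length → w.getVert i ≠ w.getVert j := by
    intro i j hij hj h
    have hin := hmin _ (((w.drop i).take (j - i)).copy rfl (by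
      rw [Walk.drop_getVert, Nat.add_sub_cancel' hij.le, h]))
    have hout := hmin _ ((w.take i).append ((w.drop j).copy h.symm rfl))
    simp only [Walk.length_copy, Walk.length_append, Walk.take_length, Walk.drop_length] at hin hout
    rcases Nat.even_or_odd (j - i) with he | ho
    · have := hout (by grind)
      omega
    · have := hin (by grind)
      omega
  intro i hi j hj h
  rcases lt_trichotomy i j with hij | hij | hij
  · exact absurd h (hne i j hij hj)
  · exact hij
  · exact absurd h.symm (hne j i hij hi)

/-! ### Enumeration of graphs encoded by numbers -/

/-- The truth table of vertex `a < 8` over the `2 ^ 8` labellings of eight vertices with two labels: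
bit `t` is the label of `a` in the labelling number `t`. The quotient has blocks of `2 ^ a` ones and
`2 ^ a` zeros in turn. -/
def truthTable (a : ℕ) : ℕ := (2 ^ 256 - 1) / (2 ^ 2 ^ a + 1)

/-- Whether, among the labellings in the set `M` (bit `t` stands for the labelling number `t`),
there is for every colouring of the pairs in `E` one under which no pair has the colour of both of
its ends. The test succeeds at once if a labelling in `M` separates the ends of every pair;
otherwise both colours of the first pair are tried. The set of all labellings is `2 ^ 256 - 1`. -/
def splitsFrom : List (ℕ × ℕ) → ℕ → Bool
  | [], M => !Nat.beq M 0
  | (a, b) :: E, M =>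
    !Nat.beq (((a, b) :: E).foldl (fun M e => M &&& (truthTable e.1 ^^^ truthTable e.2)) M) 0 ||
      (splitsFrom E (M ^^^ (M &&& (truthTable a &&& truthTable b))) &&
        splitsFrom E (M &&& (truthTable a ||| truthTable b)))

/-- Bit `i` of `A`, in a form that the kernel evaluates quickly. -/
def hasBit (A i : ℕ) : Bool := Nat.beq ((A >>> i) % 2) 1

/-- Adjacency in the graph on `0, …, 7` encoded by `A`: bit `8 * a + b` says whether `a` and `b` are
adjacent. -/
def hasEdge (A a b : ℕ) : Bool := hasBit A (8 * a + b)

/-- The code of the graph on `0, …, 7` with the given edges. -/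
def code : List (ℕ × ℕ) → ℕ
  | [] => 0
  | (a, b) :: E => code E ||| (2 ^ (8 * a + b) ||| 2 ^ (8 * b + a))

/-- The neighbourhood of `a` in the graph encoded by `A`, as a set of bits. -/
def row (A a : ℕ) : ℕ := (A >>> (8 * a)) % 2 ^ 8

/-- Whether `a` and `b` have a common neighbour in the graph encoded by `A`. -/
def joined (A a b : ℕ) : Bool := !Nat.beq (row A a &&& row A b) 0

/-- The vertices `0, …, 7`. -/
def vertices : List ℕ := [0, 1, 2, 3, 4, 5, 6, 7]

/-- The pairs `(a, b)` with `a < b < 8`. -/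
def pairs : List (ℕ × ℕ) :=
  [(0, 1), (0, 2), (0, 3), (0, 4), (0, 5), (0, 6), (0, 7), (1, 2), (1, 3), (1, 4), (1, 5), (1, 6),
    (1, 7), (2, 3), (2, 4), (2, 5), (2, 6), (2, 7), (3, 4), (3, 5), (3, 6), (3, 7), (4, 5), (4, 6),
    (4, 7), (5, 6), (5, 7), (6, 7)]

/-- Whether `a ↦ m[a]` is an isomorphism from the graph encoded by `A` to the one encoded by `B`. -/
def isIso (A B : ℕ) (m : List ℕ) : Bool :=
  vertices.all fun a => Nat.ble (m.getD a 0) 7 && vertices.all fun b =>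
    (Nat.beq a b == Nat.beq (m.getD a 0) (m.getD b 0)) &&
      (hasEdge A a b == hasEdge B (m.getD a 0) (m.getD b 0))

/-- The possible images of vertex `k` in an isomorphism from `A` to `B` that maps the vertices
`j, j - 1, …, 0` to the entries of the list: the unused vertices with the right adjacencies, as a
set of bits. -/
def candidates (A B k : ℕ) : List ℕ → ℕ → ℕ
  | [], _ => 2 ^ 8 - 1
  | y :: m, j =>
    let c := candidates A B k m (j - 1)
    let c := c ^^^ (c &&& 2 ^ y)
    bif hasEdge A k j then c &&& row B y else c ^^^ (c &&& row B y)

/-- The degree of `a` in the graph encoded by `A`. -/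
def deg (A a : ℕ) : ℕ := (vertices.filter (hasEdge A a)).length

/-- Backtracking search for an isomorphism from `A` to `B`. The argument after the codes counts the
vertices still to be mapped, and `m` lists the images chosen so far, the latest first. What is found
is verified by `isIso`, so soundness does not depend on how the search is pruned. -/
def findIso (A B : ℕ) : ℕ → List ℕ → Bool
  | 0, m => isIso A B m.reverse
  | n + 1, m => vertices.any fun y =>
      hasBit (candidates A B (7 - n) m (6 - n)) y && Nat.beq (deg B y) (deg A (7 - n)) &&
        findIso A B n (y :: m)

/-- The codes of the seven graphs `nEight`; see `nEight_adj_iff`. -/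
def nCode : Fin 7 → ℕ :=
  ![4792131411492711516, 5224760651903812890, 4729993646010140050, 4729995845033403794,
    4801208979491630172, 5306456599484310930, 5954131033854291036]

/-- Whether the graph with edges `E` and code `A` has two nonadjacent vertices without a common
neighbour, or splits, or is isomorphic to one of the two graphs `nEight 5` and `nEight 6`.
The list is reversed since `splitsFrom` is quicker when the edges of the odd cycle come first. -/
def checkMaximal (E : List (ℕ × ℕ)) (A : ℕ) : Bool :=
  (pairs.reverse.any fun e => !(joined A e.1 e.2 || hasEdge A e.1 e.2)) ||
    splitsFrom E.reverse (2 ^ 256 - 1) ||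
    findIso A (nCode 5) 8 [] || findIso A (nCode 6) 8 []

/-- Applies `checkMaximal` to all triangle-free graphs that arise from the graph with edges `E` and
code `A` by adding some of the listed pairs. -/
def checkExtensions : List (ℕ × ℕ) → List (ℕ × ℕ) → ℕ → Bool
  | [], E, A => checkMaximal E A
  | (a, b) :: ps, E, A => checkExtensions ps E A &&
      (joined A a b ||
        checkExtensions ps ((a, b) :: E) (A ||| (2 ^ (8 * a + b) ||| 2 ^ (8 * b + a))))

/-- Whether every subgraph of the graph with edges `E` splits or is isomorphic to one of the graphs
`nEight i`. Subgraphs of a splitting graph need no inspection; the first argument bounds the number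
of successive deletions. -/
def checkSubgraphs : ℕ → List (ℕ × ℕ) → Bool
  | 0, _ => false
  | n + 1, E => splitsFrom E (2 ^ 256 - 1) ||
      (((List.finRange 7).any fun i => findIso (code E) (nCode i) 8 []) &&
        E.all fun e => checkSubgraphs n (E.erase e))

/-- The edges of a 5-cycle, each with its smaller end first as in `pairs`. -/
def fiveCycle : List (ℕ × ℕ) := [(0, 1), (1, 2), (2, 3), (3, 4), (0, 4)]

/-- The edges of a 7-cycle, each with its smaller end first as in `pairs`. -/
def sevenCycle : List (ℕ × ℕ) := [(0, 1), (1, 2), (2, 3), (3, 4), (4, 5), (5, 6), (0, 6)]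

/-- The pairs that are not listed in `E`. -/
def nonedges (E : List (ℕ × ℕ)) : List (ℕ × ℕ) := pairs.filter fun e => !E.contains e

/-- The edges of `nEight i`. -/
def nEdges (i : Fin 7) : List (ℕ × ℕ) := pairs.filter fun e => hasEdge (nCode i) e.1 e.2

/-! ### Soundness of the enumeration -/

/-- Soundness of `splitsFrom`. Labellings enter only through the bits of `truthTable`, so that no
property of these numbers is needed. -/
theorem exists_testBit_of_splitsFrom (c : ℕ → ℕ → Bool) : ∀ (E : List (ℕ × ℕ)) (M : ℕ),
    splitsFrom E M = true → ∃ t, M.testBit t = true ∧ ∀ a b, (a, b) ∈ E →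
      ¬ ((truthTable a).testBit t = c a b ∧ (truthTable b).testBit t = c a b)
  | [], M, h => by
    have hM : M ≠ 0 := by
      rintro rfl
      simp [splitsFrom] at h
    obtain ⟨t, ht⟩ := Nat.exists_testBit_of_ne_zero hM
    exact ⟨t, ht, by simp⟩
  | (a, b) :: E, M, h => by
    have hfold : ∀ (E : List (ℕ × ℕ)) (M t : ℕ),
        (E.foldl (fun M e => M &&& (truthTable e.1 ^^^ truthTable e.2)) M).testBit t = true →
          M.testBit t = true ∧ ∀ a b, (a, b) ∈ E →
            (truthTable a).testBit t ≠ (truthTable b).testBit t := by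
      intro E
      induction E with
      | nil => simp
      | cons e E ih =>
        intro M t h
        obtain ⟨h₁, h₂⟩ := ih _ t h
        rw [Nat.testBit_and, Nat.testBit_xor, Bool.and_eq_true, Bool.xor_iff_ne] at h₁
        refine ⟨h₁.1, fun a b hab => ?_⟩
        rcases List.mem_cons.1 hab with rfl | hab
        · exact h₁.2
        · exact h₂ a b hab
    rw [splitsFrom, Bool.or_eq_true, Bool.and_eq_true] at h
    rcases h with h | ⟨htrue, hfalse⟩
    · obtain ⟨t, ht⟩ := Nat.exists_testBit_of_ne_zero
        (x := ((a, b) :: E).foldl (fun M e => M &&& (truthTable e.1 ^^^ truthTable e.2)) M) (by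
          intro h0
          rw [h0] at h
          simp at h)
      obtain ⟨h₁, h₂⟩ := hfold _ _ _ ht
      exact ⟨t, h₁, fun x y hxy h => h₂ x y hxy (h.1.trans h.2.symm)⟩
    · cases hc : c a b
      · obtain ⟨t, h₁, h₂⟩ := exists_testBit_of_splitsFrom c E _ hfalse
        rw [Nat.testBit_and, Nat.testBit_or, Bool.and_eq_true, Bool.or_eq_true] at h₁
        refine ⟨t, h₁.1, fun x y hxy => ?_⟩
        rcases List.mem_cons.1 hxy with h | hxy
        · obtain ⟨rfl, rfl⟩ := Prod.mk.inj h
          rintro ⟨h₃, h₄⟩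
          rw [hc] at h₃ h₄
          simp [h₃, h₄] at h₁
        · exact h₂ x y hxy
      · obtain ⟨t, h₁, h₂⟩ := exists_testBit_of_splitsFrom c E _ htrue
        simp only [Nat.testBit_xor, Nat.testBit_and] at h₁
        refine ⟨t, ?_, fun x y hxy => ?_⟩
        · by_contra hM
          simp [hM] at h₁
        rcases List.mem_cons.1 hxy with h | hxy
        · obtain ⟨rfl, rfl⟩ := Prod.mk.inj h
          rintro ⟨h₃, h₄⟩
          rw [hc] at h₃ h₄
          simp [h₃, h₄] at h₁
        · exact h₂ x y hxy

theorem splits_of_splitsFrom {G : SimpleGraph (Fin 8)} {E : List (ℕ × ℕ)} {M : ℕ}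
    (h : splitsFrom E M = true)
    (hE : ∀ a b : Fin 8, G.Adj a b → ((a : ℕ), (b : ℕ)) ∈ E ∨ ((b : ℕ), (a : ℕ)) ∈ E) :
    Splits G := by
  intro c
  obtain ⟨t, -, ht⟩ :=
    exists_testBit_of_splitsFrom (fun x y => c s(Fin.ofNat 8 x, Fin.ofNat 8 y)) E M h
  refine ⟨fun a => (truthTable a).testBit t, fun a b hab => ?_⟩
  rcases hE a b hab with h | h
  · have := ht _ _ h
    rwa [Fin.ofNat_val_eq_self, Fin.ofNat_val_eq_self] at this
  · have := ht _ _ h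
    rwa [Fin.ofNat_val_eq_self, Fin.ofNat_val_eq_self, and_comm, Sym2.eq_swap] at this

theorem hasBit_eq_testBit (A i : ℕ) : hasBit A i = A.testBit i := by
  rw [hasBit, Nat.testBit_eq_decide_div_mod_eq, Nat.shiftRight_eq_div_pow, Bool.eq_iff_iff,
    Nat.beq_eq, decide_eq_true_iff]

theorem hasEdge_code_iff (E : List (ℕ × ℕ)) (hE : ∀ e ∈ E, e.1 < 8 ∧ e.2 < 8) (a b : Fin 8) :
    hasEdge (code E) a b = true ↔
      ((a : ℕ), (b : ℕ)) ∈ E ∨ ((b : ℕ), (a : ℕ)) ∈ E := by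
  rw [hasEdge, hasBit_eq_testBit]
  induction E with
  | nil => simp [code]
  | cons e E ih =>
    obtain ⟨x, y⟩ := e
    have hxy := hE (x, y) List.mem_cons_self
    have ih := ih fun e he => hE e (List.mem_cons_of_mem _ he)
    simp only [code, Nat.testBit_or, Nat.testBit_two_pow, Bool.or_eq_true, ih, decide_eq_true_iff,
      List.mem_cons, Prod.mk.injEq]
    simp only at hxy
    have h₁ : 8 * x + y = 8 * (a : ℕ) + b ↔ (a : ℕ) = x ∧ (b : ℕ) = y := by omega
    have h₂ : 8 * y + x = 8 * (a : ℕ) + b ↔ (b : ℕ) = x ∧ (a : ℕ) = y := by omega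
    rw [h₁, h₂, or_comm, or_or_or_comm]

theorem joined_iff (A a b : ℕ) :
    joined A a b = true ↔ ∃ w : Fin 8, hasEdge A a w = true ∧ hasEdge A b w = true := by
  have hrow : ∀ a w, (row A a).testBit w = (decide (w < 8) && hasEdge A a w) := by
    intro a w
    rw [row, hasEdge, hasBit_eq_testBit, Nat.testBit_mod_two_pow, Nat.testBit_shiftRight]
  have hne : joined A a b = true ↔ row A a &&& row A b ≠ 0 := by
    rw [joined, Bool.not_eq_true', ne_eq, ← Nat.beq_eq, Bool.not_eq_true]
  rw [hne]
  constructor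
  · intro h
    obtain ⟨w, hw⟩ := Nat.exists_testBit_of_ne_zero h
    rw [Nat.testBit_and, hrow, hrow] at hw
    simp only [Bool.and_eq_true, decide_eq_true_iff] at hw
    exact ⟨⟨w, hw.1.1⟩, hw.1.2, hw.2.2⟩
  · rintro ⟨w, h₁, h₂⟩ h
    have hw : (row A a &&& row A b).testBit w = true := by
      rw [Nat.testBit_and, hrow, hrow, h₁, h₂]
      simp
    simp [h] at hw

theorem mem_vertices : ∀ a : Fin 8, (a : ℕ) ∈ vertices := by decide

theorem lt_of_mem_pairs : ∀ e ∈ pairs, e.1 < 8 ∧ e.2 < 8 := by decide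

theorem mem_pairs_or : ∀ a b : Fin 8, a ≠ b →
    ((a : ℕ), (b : ℕ)) ∈ pairs ∨ ((b : ℕ), (a : ℕ)) ∈ pairs := by decide

theorem nonempty_iso_of_isIso {G H : SimpleGraph (Fin 8)} {A B : ℕ} {m : List ℕ}
    (hG : ∀ a b : Fin 8, G.Adj a b ↔ hasEdge A a b = true)
    (hH : ∀ a b : Fin 8, H.Adj a b ↔ hasEdge B a b = true) (h : isIso A B m = true) :
    Nonempty (G ≃g H) := by
  simp only [isIso, List.all_eq_true, Bool.and_eq_true, beq_iff_eq] at h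
  have hlt : ∀ a : Fin 8, m.getD a 0 < 8 := fun a =>
    Nat.lt_succ_of_le (Nat.le_of_ble_eq_true (h a (mem_vertices a)).1)
  have hpair := fun a b : Fin 8 => (h a (mem_vertices a)).2 b (mem_vertices b)
  let φ : Fin 8 → Fin 8 := fun a => ⟨m.getD a 0, hlt a⟩
  have hφ : Function.Injective φ := by
    intro a b hab
    have := (hpair a b).1
    rw [show m.getD a 0 = m.getD b 0 from congrArg Fin.val hab, Nat.beq_refl] at this
    exact Fin.ext (Nat.eq_of_beq_eq_true this)
  exact ⟨⟨Equiv.ofBijective φ (Finite.injective_iff_bijective.1 hφ), fun {a b} =>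
    by
    rw [hG, (hpair a b).2]
    exact hH (φ a) (φ b)⟩⟩

theorem nonempty_iso_of_findIso {G H : SimpleGraph (Fin 8)} {A B : ℕ}
    (hG : ∀ a b : Fin 8, G.Adj a b ↔ hasEdge A a b = true)
    (hH : ∀ a b : Fin 8, H.Adj a b ↔ hasEdge B a b = true) :
    ∀ (n : ℕ) (m : List ℕ), findIso A B n m = true → Nonempty (G ≃g H)
  | 0, _, h => nonempty_iso_of_isIso hG hH h
  | n + 1, m, h => by
    rw [findIso, List.any_eq_true] at h
    obtain ⟨y, -, h⟩ := h
    exact nonempty_iso_of_findIso hG hH n _ (Bool.and_eq_true _ _ ▸ h).2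

/-! ### Triangle-free graphs on eight vertices -/

theorem checkExtensions_fiveCycle :
    checkExtensions (nonedges fiveCycle) fiveCycle.reverse (code fiveCycle.reverse) = true := by
  decide +kernel

theorem checkExtensions_sevenCycle :
    checkExtensions (nonedges sevenCycle) sevenCycle.reverse (code sevenCycle.reverse) = true := by
  decide +kernel

theorem checkSubgraphs_nEdges_five : checkSubgraphs 4 (nEdges 5) = true := by
  decide +kernel

theorem checkSubgraphs_nEdges_six : checkSubgraphs 4 (nEdges 6) = true := by
  decide +kernel

theorem nEight_adj_iff : ∀ (i : Fin 7) (a b : Fin 8),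
    (nEight i).Adj a b ↔ hasEdge (nCode i) a b = true := by
  simp only [nEight, fromEdgeSet_adj, Finset.mem_coe]
  decide +kernel

/-- A subgraph of the graph with edges `E` is that graph itself or misses an edge of it, in which
case it is a subgraph of the graph with that edge deleted. -/
theorem splits_or_iso_of_checkSubgraphs {G : SimpleGraph (Fin 8)} :
    ∀ (n : ℕ) (E : List (ℕ × ℕ)), (∀ e ∈ E, e.1 < 8 ∧ e.2 < 8) →
      (∀ a b : Fin 8, G.Adj a b → ((a : ℕ), (b : ℕ)) ∈ E ∨ ((b : ℕ), (a : ℕ)) ∈ E) →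
      checkSubgraphs n E = true → Splits G ∨ ∃ i : Fin 7, Nonempty (G ≃g nEight i)
  | n + 1, E, hE, hG, h => by
    rw [checkSubgraphs, Bool.or_eq_true, Bool.and_eq_true, List.any_eq_true,
      List.all_eq_true] at h
    rcases h with h | ⟨⟨i, -, hi⟩, h⟩
    · exact .inl (splits_of_splitsFrom h hG)
    -- Either `G` has all edges of `E`, or one of them can be erased from `E`.
    by_cases hall : ∀ a b : Fin 8, ((a : ℕ), (b : ℕ)) ∈ E → G.Adj a b
    · refine .inr ⟨i, nonempty_iso_of_findIso (fun a b => ?_) (nEight_adj_iff i) _ _ hi⟩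
      rw [hasEdge_code_iff E hE]
      exact ⟨hG a b, fun h => h.elim (hall a b) fun h => (hall b a h).symm⟩
    · push Not at hall
      obtain ⟨a, b, hab, hnot⟩ := hall
      refine splits_or_iso_of_checkSubgraphs n (E.erase (a, b))
        (fun e he => hE e (List.mem_of_mem_erase he)) (fun x y hxy => ?_) (h _ hab)
      refine (hG x y hxy).imp (fun h => (List.mem_erase_of_ne ?_).2 h)
        fun h => (List.mem_erase_of_ne ?_).2 h
      · intro h
        simp only [Prod.mk.injEq, Fin.val_inj] at h
        exact hnot (h.1 ▸ h.2 ▸ hxy)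
      · intro h
        simp only [Prod.mk.injEq, Fin.val_inj] at h
        exact hnot (h.1 ▸ h.2 ▸ hxy.symm)

/-- Adding a missing edge to a maximal triangle-free graph creates a triangle. -/
theorem exists_common_neighbor_of_maximal {V : Type*} {G : SimpleGraph V}
    (hG : Maximal (fun H : SimpleGraph V => H.CliqueFree 3) G) {x y : V} (hne : x ≠ y)
    (hxy : ¬ G.Adj x y) : ∃ w, G.Adj x w ∧ G.Adj y w := by
  classical
  obtain ⟨s, hx, hy, hxs, hys⟩ := exists_of_maximal_cliqueFree_not_adj hG hne hxy
  have hcard : s.card = 1 := by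
    have := hxs.card_eq
    rw [Finset.card_insert_of_notMem hx] at this
    omega
  obtain ⟨w, rfl⟩ := Finset.card_eq_one.1 hcard
  rw [Finset.mem_singleton] at hx hy
  exact ⟨w, hxs.isClique (by simp) (by simp) hx, hys.isClique (by simp) (by simp) hy⟩

/-- Soundness of `checkExtensions` for a triangle-free graph that contains `E` and is contained in
`E` together with the pairs `ps`, and in which any two nonadjacent vertices have a common
neighbour. -/
theorem splits_or_iso_of_checkExtensions {G : SimpleGraph (Fin 8)}
    (hfree : G.CliqueFree 3)
    (hdiam : ∀ x y, x ≠ y → ¬ G.Adj x y → ∃ w, G.Adj x w ∧ G.Adj y w) :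
    ∀ (ps E : List (ℕ × ℕ)), (∀ e ∈ ps, e.1 < 8 ∧ e.2 < 8) → (∀ e ∈ E, e.1 < 8 ∧ e.2 < 8) →
      (∀ a b : Fin 8, ((a : ℕ), (b : ℕ)) ∈ E → G.Adj a b) →
      (∀ a b : Fin 8, G.Adj a b → (((a : ℕ), (b : ℕ)) ∈ E ∨ ((b : ℕ), (a : ℕ)) ∈ E) ∨
        (((a : ℕ), (b : ℕ)) ∈ ps ∨ ((b : ℕ), (a : ℕ)) ∈ ps)) →
      checkExtensions ps E (code E) = true →
      Splits G ∨ Nonempty (G ≃g nEight 5) ∨ Nonempty (G ≃g nEight 6)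
  | [], E, _, hE, hEG, hGE, h => by
    have hadj : ∀ a b : Fin 8, G.Adj a b ↔ hasEdge (code E) a b = true := by
      intro a b
      rw [hasEdge_code_iff E hE]
      exact ⟨fun h => by simpa using hGE a b h,
        fun h => h.elim (hEG a b) fun h => (hEG b a h).symm⟩
    simp only [checkExtensions, checkMaximal, Bool.or_eq_true] at h
    rcases h with ((h | h) | h) | h
    · rw [List.any_eq_true] at h
      obtain ⟨⟨a, b⟩, hab, h⟩ := h
      rw [List.mem_reverse] at hab
      have hlt : a < 8 ∧ b < 8 := lt_of_mem_pairs _ hab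
      have hne : a ≠ b := (by decide : ∀ e ∈ pairs, e.1 ≠ e.2) _ hab
      lift a to Fin 8 using hlt.1
      lift b to Fin 8 using hlt.2
      rw [Bool.not_eq_true', Bool.or_eq_false_iff, ← Bool.not_eq_true, ← Bool.not_eq_true, ← hadj,
        joined_iff] at h
      obtain ⟨w, hw⟩ := hdiam a b (fun h => hne (h ▸ rfl)) h.2
      exact absurd ⟨w, (hadj _ _).1 hw.1, (hadj _ _).1 hw.2⟩ h.1
    · refine .inl (splits_of_splitsFrom h fun a b hab => ?_)
      simpa using hGE a b hab
    · exact .inr (.inl (nonempty_iso_of_findIso hadj (nEight_adj_iff 5) _ _ h))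
    · exact .inr (.inr (nonempty_iso_of_findIso hadj (nEight_adj_iff 6) _ _ h))
  | (a, b) :: ps, E, hps, hE, hEG, hGE, h => by
    have hlt : a < 8 ∧ b < 8 := hps _ List.mem_cons_self
    have hps' := fun e he => hps e (List.mem_cons_of_mem _ he)
    lift a to Fin 8 using hlt.1
    lift b to Fin 8 using hlt.2
    rw [checkExtensions, Bool.and_eq_true, Bool.or_eq_true] at h
    obtain ⟨hwithout, hwith⟩ := h
    by_cases hab : G.Adj a b
    · rcases hwith with h | h
      · rw [joined_iff] at h
        obtain ⟨w, h₁, h₂⟩ := h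
        rw [hasEdge_code_iff E hE] at h₁ h₂
        exact absurd hab (cliqueFree_three_iff.1 hfree w a b
          (h₁.elim (fun h => (hEG _ _ h).symm) (hEG _ _))
          (h₂.elim (fun h => (hEG _ _ h).symm) (hEG _ _)))
      · refine splits_or_iso_of_checkExtensions hfree hdiam ps _ hps' ?_ ?_ ?_ h
        · exact List.forall_mem_cons.2 ⟨hlt, hE⟩
        · intro x y hxy
          rcases List.mem_cons.1 hxy with h | h
          · simp only [Prod.mk.injEq, Fin.val_inj] at h
            exact h.1 ▸ h.2 ▸ hab
          · exact hEG x y h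
        · intro x y hxy
          have := hGE x y hxy
          simp only [List.mem_cons] at this ⊢
          tauto
    · refine splits_or_iso_of_checkExtensions hfree hdiam ps E hps' hE hEG (fun x y hxy => ?_)
        hwithout
      have h := hGE x y hxy
      simp only [List.mem_cons, Prod.mk.injEq, Fin.val_inj] at h
      have h₁ : ¬ (x = a ∧ y = b) := fun h => hab (h.1 ▸ h.2 ▸ hxy)
      have h₂ : ¬ (y = a ∧ x = b) := fun h => hab (h.1 ▸ h.2 ▸ hxy.symm)
      tauto

theorem splits_or_iso_of_cycle {G : SimpleGraph (Fin 8)}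
    (hfree : G.CliqueFree 3)
    (hdiam : ∀ x y, x ≠ y → ¬ G.Adj x y → ∃ w, G.Adj x w ∧ G.Adj y w) {C : List (ℕ × ℕ)}
    (hC : ∀ e ∈ C, e.1 < 8 ∧ e.2 < 8)
    (h : checkExtensions (nonedges C) C.reverse (code C.reverse) = true)
    (hCG : ∀ a b : Fin 8, ((a : ℕ), (b : ℕ)) ∈ C → G.Adj a b) :
    Splits G ∨ Nonempty (G ≃g nEight 5) ∨ Nonempty (G ≃g nEight 6) := by
  refine splits_or_iso_of_checkExtensions hfree hdiam _ _
    (fun e he => lt_of_mem_pairs e (List.mem_of_mem_filter he)) (by simpa using hC)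
    (by simpa using hCG) (fun a b hab => ?_) h
  have := mem_pairs_or a b hab.ne
  simp only [List.mem_filter, List.mem_reverse, Bool.not_eq_true', List.contains_eq_mem,
    decide_eq_false_iff_not]
  tauto

theorem exists_perm_extending {n k : ℕ} (hk : k ≤ n) (u : ℕ → Fin n)
    (hu : Set.InjOn u (Set.Iio k)) :
    ∃ σ : Equiv.Perm (Fin n), ∀ a : Fin n, (a : ℕ) < k → σ a = u a := by
  let e : Fin k ↪ Fin n := ⟨fun i => u i, fun i j h => Fin.ext (hu i.2 j.2 h)⟩
  have := Equiv.Perm.isMultiplyPretransitive (Fin n) k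
  obtain ⟨σ, hσ⟩ := MulAction.exists_smul_eq (Equiv.Perm (Fin n)) (Fin.castLEEmb hk) e
  exact ⟨σ, fun a ha => congrArg (fun f : Fin k ↪ Fin n => f ⟨a, ha⟩) hσ⟩

/-- A maximal triangle-free graph on eight vertices splits or is the Wagner graph `nEight 5` or
`nEight 6`. The vertices are relabelled so that a shortest odd cycle becomes `fiveCycle` or
`sevenCycle`. -/
theorem splits_or_iso_of_maximal {G : SimpleGraph (Fin 8)}
    (hfree : G.CliqueFree 3)
    (hdiam : ∀ x y, x ≠ y → ¬ G.Adj x y → ∃ w, G.Adj x w ∧ G.Adj y w) :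
    Splits G ∨ Nonempty (G ≃g nEight 5) ∨ Nonempty (G ≃g nEight 6) := by
  by_cases hcol : G.Colorable 2
  · exact .inl (.of_colorable_two hcol)
  obtain ⟨n, u, hodd, hinj, hclose, hadj⟩ := exists_odd_cycle_of_not_colorable_two hcol
  have hn : n ≤ 8 := by
    simpa using Finset.card_le_card_of_injOn (s := Finset.range n) (t := Finset.univ) u (by simp)
      (by simpa [Set.InjOn] using hinj)
  -- Length 1 is a loop and length 3 a triangle.
  have hn57 : n = 5 ∨ n = 7 := by
    have h₁ : n ≠ 1 := by
      rintro rfl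
      exact (hadj 0 (by simp)).ne hclose.symm
    have h₃ : n ≠ 3 := by
      rintro rfl
      exact cliqueFree_three_iff.1 hfree (u 1) (u 0) (u 2) (hadj 0 (by simp)).symm
        (hadj 1 (by simp)) (hclose ▸ (hadj 2 (by simp)).symm)
    obtain ⟨k, rfl⟩ := hodd
    omega
  obtain ⟨σ, hσ⟩ := exists_perm_extending hn u hinj
  let e : G.comap σ ≃g G := Iso.comap σ G
  have hfree' : (G.comap σ).CliqueFree 3 :=
    cliqueFree_three_iff.2 fun x y z => cliqueFree_three_iff.1 hfree (σ x) (σ y) (σ z)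
  have hdiam' : ∀ x y, x ≠ y → ¬ (G.comap σ).Adj x y →
      ∃ w, (G.comap σ).Adj x w ∧ (G.comap σ).Adj y w := by
    intro x y hne hxy
    obtain ⟨w, hw⟩ := hdiam (σ x) (σ y) (σ.injective.ne hne) hxy
    obtain ⟨w, rfl⟩ := σ.surjective w
    exact ⟨w, hw⟩
  have hstep : ∀ a b : Fin 8, (b : ℕ) < n → (b : ℕ) = a + 1 → (G.comap σ).Adj a b := by
    intro a b hb hab
    rw [comap_adj, hσ a (by omega), hσ b hb, hab]
    exact hadj _ (by omega)
  have hlast : ∀ a b : Fin 8, (a : ℕ) = 0 → (b : ℕ) + 1 = n → (G.comap σ).Adj a b := by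
    intro a b ha hb
    rw [comap_adj, hσ a (by omega), hσ b (by omega), ha, ← hclose, ← hb]
    exact (hadj _ (by omega)).symm
  have key : Splits (G.comap σ) ∨ Nonempty (G.comap σ ≃g nEight 5) ∨
      Nonempty (G.comap σ ≃g nEight 6) := by
    rcases hn57 with rfl | rfl
    · refine splits_or_iso_of_cycle hfree' hdiam' (by decide) checkExtensions_fiveCycle
        fun a b hab => ?_
      simp only [fiveCycle, List.mem_cons, Prod.mk.injEq, List.not_mem_nil, or_false] at hab
      by_cases h : (b : ℕ) = a + 1
      · exact hstep a b (by omega) h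
      · exact hlast a b (by omega) (by omega)
    · refine splits_or_iso_of_cycle hfree' hdiam' (by decide) checkExtensions_sevenCycle
        fun a b hab => ?_
      simp only [sevenCycle, List.mem_cons, Prod.mk.injEq, List.not_mem_nil, or_false] at hab
      by_cases h : (b : ℕ) = a + 1
      · exact hstep a b (by omega) h
      · exact hlast a b (by omega) (by omega)
  exact key.imp (fun h => h.of_injective_hom e.symm.toHom e.symm.injective)
    (Or.imp (fun ⟨φ⟩ => ⟨e.symm.trans φ⟩) fun ⟨φ⟩ => ⟨e.symm.trans φ⟩)

theorem splits_or_iso_nEight {G : SimpleGraph (Fin 8)} (hG : G.CliqueFree 3) :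
    Splits G ∨ ∃ i : Fin 7, Nonempty (G ≃g nEight i) := by
  obtain ⟨G', hGG', hmax⟩ := Finite.exists_le_maximal
    (p := fun H : SimpleGraph (Fin 8) => H.CliqueFree 3) hG
  have hsub : ∀ i, checkSubgraphs 4 (nEdges i) = true → Nonempty (G' ≃g nEight i) →
      Splits G ∨ ∃ i : Fin 7, Nonempty (G ≃g nEight i) := by
    rintro i hi ⟨φ⟩
    let e : G ≃g G.map φ.toEquiv.toEmbedding := Iso.map φ.toEquiv G
    have hle : G.map φ.toEquiv.toEmbedding ≤ nEight i := by
      rw [map_le_iff_le_comap]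
      intro a b hab
      exact φ.map_adj_iff.2 (hGG' hab)
    refine (splits_or_iso_of_checkSubgraphs (G := G.map φ.toEquiv.toEmbedding) 4 (nEdges i)
      (fun e he => lt_of_mem_pairs e (List.mem_of_mem_filter he)) (fun a b hab => ?_) hi).imp
      (fun h => h.of_injective_hom e.toHom e.injective) fun ⟨j, ⟨ψ⟩⟩ => ⟨j, ⟨e.trans ψ⟩⟩
    simp only [nEdges, List.mem_filter, ← nEight_adj_iff]
    exact (mem_pairs_or a b hab.ne).imp (fun h => ⟨h, hle hab⟩)
      fun h => ⟨h, hle hab.symm⟩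
  rcases splits_or_iso_of_maximal hmax.prop
    fun _ _ => exists_common_neighbor_of_maximal hmax with h | h | h
  · exact .inl (h.mono hGG')
  · exact hsub 5 checkSubgraphs_nEdges_five h
  · exact hsub 6 checkSubgraphs_nEdges_six h

/-! ### Neighbourhoods with at most eight vertices -/

theorem exists_nEight_adj (i : Fin 7) (b : Fin 8) : ∃ a, (nEight i).Adj a b := by
  simp only [nEight_adj_iff]
  decide +revert +kernel

theorem card_eq_eight_and_iso {V : Type*} [Fintype V] {K : SimpleGraph V} (hK : K.CliqueFree 3)
    (hsplit : ¬ Splits K) (hcard : Fintype.card V ≤ 8) :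
    Fintype.card V = 8 ∧ ∃ i : Fin 7, Nonempty (K ≃g nEight i) := by
  classical
  obtain ⟨ι⟩ : Nonempty (V ↪ Fin 8) :=
    Function.Embedding.nonempty_of_card_le (by simpa using hcard)
  have hfree : (K.map ι).CliqueFree 3 := by
    have : Nonempty V := by
      by_contra h
      rw [not_nonempty_iff] at h
      exact hsplit fun c => ⟨isEmptyElim, isEmptyElim⟩
    exact cliqueFree_map_iff.2 hK
  obtain ⟨i, ⟨φ⟩⟩ := (splits_or_iso_nEight hfree).resolve_left fun h =>
    hsplit (h.of_injective_hom (Embedding.map ι K).toHom ι.injective)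
  -- A vertex outside the range of `ι` would be isolated.
  have hsurj : Function.Surjective ι := by
    intro b
    obtain ⟨a, ha⟩ := exists_nEight_adj i (φ b)
    obtain ⟨a, rfl⟩ := φ.surjective a
    rw [φ.map_adj_iff, map_adj] at ha
    obtain ⟨_, y, _, _, hy⟩ := ha
    exact ⟨y, hy⟩
  let e := Equiv.ofBijective ι ⟨ι.injective, hsurj⟩
  refine ⟨by simpa using Fintype.card_congr e, i, ⟨RelIso.trans ⟨e, fun {a b} => ?_⟩ φ⟩⟩
  exact (Embedding.map ι K).map_adj_iff

end FolkmanNeighborhood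

theorem mainTheorem11 {V : Type*} [Fintype V] (G : SimpleGraph V) [DecidableRel G.Adj]
    (hG : IsMinimalEdgeFolkman G 3 3 4) :
    8 ≤ G.minDegree ∧
      ∀ v : V, G.degree v = 8 →
        ∃ i : Fin 7, Nonempty (G.induce (G.neighborSet v) ≃g nEight i) := by
  have key : ∀ v, G.degree v ≤ 8 → G.degree v = 8 ∧
      ∃ i : Fin 7, Nonempty (G.induce (G.neighborSet v) ≃g nEight i) := by
    intro v hv
    rw [← G.card_neighborSet_eq_degree] at hv ⊢
    exact FolkmanNeighborhood.card_eq_eight_and_iso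
      (FolkmanNeighborhood.cliqueFree_three_induce_neighborSet hG.1.2 v)
      (FolkmanNeighborhood.not_splits_neighborSet hG v) hv
  have : Nonempty V := by
    by_contra h
    rw [not_nonempty_iff] at h
    obtain ⟨x, -⟩ := FolkmanNeighborhood.edgeArrows_three_three_iff.1 hG.1.1 fun _ => true
    exact h.elim x
  refine ⟨G.le_minDegree_of_forall_le_degree 8 fun v => ?_, fun v hv => (key v hv.le).2⟩
  rcases le_total (G.degree v) 8 with h | h
  · exact (key v h).1.ge
  · exact h
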